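/- Let $V$ be a finite-dimensional real vector space and let $\mathcal{A}$ be a finite set of linear hyperplanes of $V$ (a real central hyperplane arrangement) that is essential, i.e. $\bigcap_{H\in\mathcal{A}}H=\{\mathbf 0\}$. Let $\mathcal{L}_{\mathcal{A}}$ be the set of all intersections of subsets of $\mathcal{A}$ (including $V$, the empty intersection), ordered by inverse inclusion, with Möbius function $\mu$, let $\chi(\mathcal{A},t)=\sum_{X\in\mathcal{L}_{\mathcal{A}}}\mu(V,X)\,t^{\dim X}$ be the characteristic polynomial, and let $$\beta(\mathcal{A})=(-1)^{\operatorname{rank}(\mathcal{A})-1}\cdot\frac{\mathrm{d}\chi(\mathcal{A},t)}{\mathrm{d}t}\Big|_{t=1},\qquad \operatorname{rank}(\mathcal{A})=\dim V-\dim\bigcap_{H\in\mathcal{A}}H=\dim V,$$ be Crapo's beta invariant. The chambers of $\mathcal{A}$ are the closures of the connected components of $V\setminus\bigcup_{H\in\mathcal{A}}H$. Then for every hyperplane $H\in\mathcal{A}$ the number of chambers $C$ with $C\cap H=\{\mathbf 0\}$ is finite, and $$\beta(\mathcal{A})=\tfrac12\,\bigl|\{C \text{ a chamber of }\mathcal{A}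 : C\cap H=\{\mathbf 0\}\}\bigr|.$$ -/

import Mathlib

/-- A (finite) central hyperplane arrangement in a real vector space `V`: a finite set of linear
hyperplanes, i.e. of linear subspaces of codimension one. -/
structure CentralArrangement (V : Type*) [AddCommGroup V] [Module ℝ V] where
  /-- The hyperplanes of the arrangement. -/
  hyperplanes : Finset (Submodule ℝ V)
  /-- Every member has codimension one. -/
  finrank_quotient : ∀ H ∈ hyperplanes, Module.finrank ℝ (V ⧸ H) = 1

namespace CentralArrangement

section Algebra

variable {V : Type*} [AddCommGroup V] [Module ℝ V] (A : CentralArrangement V)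

/-- The center of the arrangement: the intersection of all its hyperplanes. -/
def center : Submodule ℝ V := A.hyperplanes.inf id

/-- The arrangement is essential if its hyperplanes meet exactly at the origin. -/
def IsEssential : Prop := A.center = ⊥

/-- The rank: the codimension of the center. -/
noncomputable def rank : ℕ := Module.finrank ℝ (V ⧸ A.center)

open Classical in
/-- The flats: all intersections of sets of hyperplanes of the arrangement; the empty set of
hyperplanes gives the flat `V`. -/
noncomputable def flats : Finset (Submodule ℝ V) :=
  A.hyperplanes.powerset.image fun B => B.inf id

theorem top_mem_flats : (⊤ : Submodule ℝ V) ∈ A.flats := by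
  classical
  exact Finset.mem_image.2 ⟨∅, Finset.empty_mem_powerset _, Finset.inf_empty⟩

/-- The intersection lattice: the flats, ordered by inverse inclusion. -/
abbrev IntersectionLattice : Type _ := {X : Submodule ℝ V // X ∈ A.flats}ᵒᵈ

open Classical in
noncomputable instance : LocallyFiniteOrder A.IntersectionLattice :=
  Fintype.toLocallyFiniteOrder

/-- The whole space, which is the least element of the intersection lattice. -/
def wholeSpace : A.IntersectionLattice := OrderDual.toDual ⟨⊤, A.top_mem_flats⟩

open Classical in
/-- The characteristic polynomial `χ(A, t) = ∑_X μ(V, X) t ^ dim X`, summed over all flats `X`,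
where `μ` is the Möbius function of the intersection lattice. -/
noncomputable def charPoly : Polynomial ℤ :=
  ∑ X : A.IntersectionLattice,
    Polynomial.C (IncidenceAlgebra.mu ℤ A.wholeSpace X) *
      Polynomial.X ^ Module.finrank ℝ (OrderDual.ofDual X : {X : Submodule ℝ V // X ∈ A.flats}).1

/-- Crapo's beta invariant `(-1) ^ (rank A - 1) * χ'(A, 1)`. A nonempty arrangement has positive rank,
so the exponent is not truncated; an essential arrangement of rank zero has `χ = 1`, so that the
sign does not matter. -/
noncomputable def beta : ℤ :=
  (-1) ^ (A.rank - 1) * (Polynomial.derivative A.charPoly).eval 1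

/-- The complement in `V` of the union of the hyperplanes. -/
def complement : Set V := {v | ∀ H ∈ A.hyperplanes, v ∉ H}

end Algebra

/-- The (closed) chambers: the closures of the connected components of the complement of the
union of the hyperplanes. -/
def chambers {V : Type*} [AddCommGroup V] [Module ℝ V] [TopologicalSpace V]
    (A : CentralArrangement V) : Set (Set V) :=
  {C | ∃ v ∈ A.complement, C = closure (connectedComponentIn A.complement v)}

end CentralArrangement

/-!
By Whitney's theorem (`sum_mu_mul`), `χ'(1)` is the sum of `(-1) ^ |B| dim (⋂ B)` over all sets `B` of
hyperplanes. Pairing the sets without `H` with those containing `H`, the beta invariant becomes, up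
to sign, the sum of `(-1) ^ |B|` over the sets `B` of hyperplanes other than `H` whose intersection is
not contained in `H` (`beta_eq_sum`). With `g` a linear form defining `H`, these are the sets whose
hyperplanes have a common point in the affine slice `g = 1`.

On the other side, the chambers on which `0 ≤ g` are the cones over the cells that the other
hyperplanes cut out of this slice, and such a chamber meets `H` only at the origin exactly when its
cell is bounded. Zaslavsky's count of bounded cells (`sum_boundedCell`) says that their number is the
alternating sum above. It follows by deletion-restriction, which holds cell by cell
(`boundedCell_deletion_restriction`): cutting a cell by one more hyperplane produces an additional
bounded cell if and only if the trace of that hyperplane on the cell is nonempty and bounded,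
provided the remaining arrangement is still essential; if it is not, both sides of the count vanish.
The chambers on the other side of `H` are counted in the same way with `-g`, whence the factor `2`.
-/

open Filter Topology in
theorem exists_pos_forall_pos_add_smul {V : Type*} [AddCommGroup V] [Module ℝ V]
    {T : Set (Module.Dual ℝ V)} (hT : T.Finite) {x : V} (hx : ∀ φ ∈ T, 0 < φ x) (u : V) :
    ∃ ε : ℝ, 0 < ε ∧ ∀ φ ∈ T, 0 < φ (x + ε • u) := by
  have h : ∀ᶠ ε : ℝ in 𝓝[>] 0, ∀ φ ∈ T, 0 < φ (x + ε • u) := by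
    rw [Filter.eventually_all_finite hT]
    intro φ hφ
    have hc : Tendsto (fun ε : ℝ => φ x + ε * φ u) (𝓝[>] 0) (𝓝 (φ x + 0 * φ u)) :=
      (Continuous.tendsto (by fun_prop) 0).mono_left nhdsWithin_le_nhds
    rw [zero_mul, add_zero] at hc
    filter_upwards [hc.eventually_const_lt (hx φ hφ)] with ε hε
    simpa using hε
  obtain ⟨ε, h1, h2⟩ := (h.and self_mem_nhdsWithin).exists
  exact ⟨ε, h2, h1⟩

namespace CentralArrangement

/-! ### Bounded cells and deletion-restriction -/

section BoundedCells

variable {V : Type*} [AddCommGroup V] [Module ℝ V]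

/-- The family `T` of linear forms, restricted to the subspace `W`, cuts out a nonempty bounded cell of
the affine slice `{x ∈ W | g x = 1}`. This is encoded homogeneously: the open cone over the cell,
defined by `0 < g` and `0 < φ` for `φ ∈ T`, is nonempty, and the recession cone of the closed cell
(`g = 0` and `0 ≤ φ` for `φ ∈ T`) is trivial. -/
def BoundedCell (T : Set (Module.Dual ℝ V)) (g : Module.Dual ℝ V) (W : Submodule ℝ V) : Prop :=
  (∃ x ∈ W, 0 < g x ∧ ∀ φ ∈ T, 0 < φ x) ∧
    ∀ x ∈ W, g x = 0 → (∀ φ ∈ T, 0 ≤ φ x) → x = 0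

variable {T : Set (Module.Dual ℝ V)} {g k : Module.Dual ℝ V} {W : Submodule ℝ V}

theorem BoundedCell.of_insert (h : BoundedCell (insert k T) g W)
    (hk : ∀ x ∈ W, g x = 0 → (∀ φ ∈ T, 0 ≤ φ x) → 0 ≤ k x) : BoundedCell T g W := by
  obtain ⟨⟨x, hx, hgx, hTx⟩, h⟩ := h
  refine ⟨⟨x, hx, hgx, fun φ hφ => hTx φ (Or.inr hφ)⟩, fun y hy hgy hTy => h y hy hgy ?_⟩
  rintro φ (rfl | hφ)
  exacts [hk y hy hgy hTy, hTy φ hφ]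

/-- If the cell of `T` in `W` does not meet `ker k`, then it lies on one side of `ker k`, and
cutting by `ker k` changes nothing. -/
theorem boundedCell_insert_iff_of_pos (hne : ∃ x ∈ W, 0 < g x ∧ ∀ φ ∈ T, 0 < φ x)
    (hpos : ∀ x ∈ W, 0 < g x → (∀ φ ∈ T, 0 < φ x) → 0 < k x) :
    BoundedCell (insert k T) g W ↔ BoundedCell T g W := by
  obtain ⟨x, hx, hgx, hTx⟩ := hne
  constructor
  · intro h
    refine h.of_insert fun y hy hgy hTy => ?_
    -- If `k y < 0`, a point of the ray from `x` in the direction `y` lies on `ker k`.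
    by_contra! hky
    have hkx := hpos x hx hgx hTx
    have := hpos (x + (k x / -k y) • y) (W.add_mem hx (W.smul_mem _ hy)) (by simp [hgy, hgx])
      fun φ hφ => by
        have h1 := hTx φ hφ
        have h2 := hTy φ hφ
        have h3 : 0 < k x / -k y := div_pos hkx (by linarith)
        simp only [map_add, map_smul, smul_eq_mul]
        positivity
    simp only [map_add, map_smul, smul_eq_mul] at this
    have h4 : k x / -k y * k y = -k x := by
      have := hky.ne
      field_simp
    linarith
  · rintro ⟨-, h⟩
    refine ⟨⟨x, hx, hgx, ?_⟩, fun y hy hgy hTy => h y hy hgy fun φ hφ => hTy φ (Or.inr hφ)⟩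
    rintro φ (rfl | hφ)
    exacts [hpos x hx hgx hTx, hTx φ hφ]

/-- If `ker k` meets a cell and `k` does not vanish on `W`, the cell has points on the side `0 < k`
(and, applied to `-k`, on the other side). -/
theorem exists_mem_insert_of_eq_zero (hT : T.Finite) {u : V} (hu : u ∈ W) (hku : 0 < k u)
    (h0 : ∃ x ∈ W, k x = 0 ∧ 0 < g x ∧ ∀ φ ∈ T, 0 < φ x) :
    ∃ x ∈ W, 0 < g x ∧ ∀ φ ∈ insert k T, 0 < φ x := by
  obtain ⟨x, hx, hkx, hgx, hTx⟩ := h0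
  obtain ⟨ε, hε, h⟩ := exists_pos_forall_pos_add_smul (hT.insert g) (x := x)
    (by rintro φ (rfl | hφ); exacts [hgx, hTx φ hφ]) u
  refine ⟨x + ε • u, W.add_mem hx (W.smul_mem _ hu), h g (Or.inl rfl), ?_⟩
  rintro φ (rfl | hφ)
  · simp only [map_add, map_smul, smul_eq_mul, hkx]
    positivity
  · exact h φ (Or.inr hφ)

/-- If the trace of an essential cell on `ker k` is bounded, the cell does not recede on both sides of
`ker k`: recession directions `u` and `v` on the two sides would combine to one in `ker k`, hence be
opposite and span a line on which `g` and all of `T` vanish. -/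
theorem eq_zero_of_mem_recession
    (hess : ∀ x ∈ W, g x = 0 → (∀ φ ∈ T, φ x = 0) → x = 0)
    (h0 : ∀ x ∈ W, k x = 0 → g x = 0 → (∀ φ ∈ T, 0 ≤ φ x) → x = 0)
    {u v : V} (hu : u ∈ W) (hgu : g u = 0) (hTu : ∀ φ ∈ T, 0 ≤ φ u) (hku : 0 ≤ k u) (hu0 : u ≠ 0)
    (hv : v ∈ W) (hgv : g v = 0) (hTv : ∀ φ ∈ T, 0 ≤ φ v) (hkv : k v ≤ 0) : v = 0 := by
  have hku' : 0 < k u := lt_of_le_of_ne hku fun h => hu0 (h0 u hu h.symm hgu hTu)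
  have hw := h0 ((-k v) • u + k u • v) (W.add_mem (W.smul_mem _ hu) (W.smul_mem _ hv))
    (by simp; ring) (by simp [hgu, hgv]) fun φ hφ => by
      have h1 := mul_nonneg (neg_nonneg.2 hkv) (hTu φ hφ)
      have h2 := mul_nonneg hku (hTv φ hφ)
      simp only [map_add, map_smul, smul_eq_mul]
      linarith
  refine hess v hv hgv fun φ hφ => le_antisymm ?_ (hTv φ hφ)
  have h1 := congrArg φ hw
  simp only [map_add, map_smul, smul_eq_mul, map_zero] at h1
  have h2 := mul_nonneg (neg_nonneg.2 hkv) (hTu φ hφ)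
  by_contra! h3
  have := mul_pos hku' h3
  linarith

theorem not_boundedCell_of_empty (h : ¬∃ x ∈ W, 0 < g x ∧ ∀ φ ∈ T, 0 < φ x) :
    ¬BoundedCell T g W := fun h' => h h'.1

theorem boundedCell_inf_ker :
    BoundedCell T g (W ⊓ LinearMap.ker k) ↔
      (∃ x ∈ W, k x = 0 ∧ 0 < g x ∧ ∀ φ ∈ T, 0 < φ x) ∧
        ∀ x ∈ W, k x = 0 → g x = 0 → (∀ φ ∈ T, 0 ≤ φ x) → x = 0 := by
  simp [BoundedCell, and_assoc]

open Classical in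
/-- Deletion-restriction for a single cell: cutting along `ker k` a cell of an essential family
creates as many new bounded cells as `ker k` has bounded traces on it. -/
theorem boundedCell_deletion_restriction (hT : T.Finite) (hk : ∃ u ∈ W, k u ≠ 0)
    (hess : ∀ x ∈ W, g x = 0 → (∀ φ ∈ T, φ x = 0) → x = 0) :
    ((if BoundedCell (insert k T) g W then 1 else 0) +
        (if BoundedCell (insert (-k) T) g W then 1 else 0) : ℤ) =
      (if BoundedCell T g W then 1 else 0) +
        (if BoundedCell T g (W ⊓ LinearMap.ker k) then 1 else 0) := by
  rw [boundedCell_inf_ker]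
  by_cases hne : ∃ x ∈ W, 0 < g x ∧ ∀ φ ∈ T, 0 < φ x
  swap
  · have h1 : ∀ l, ¬BoundedCell (insert l T) g W := fun l h =>
      hne (h.1.imp fun x hx => ⟨hx.1, hx.2.1, fun φ hφ => hx.2.2 φ (Or.inr hφ)⟩)
    rw [if_neg (h1 k), if_neg (h1 (-k)), if_neg (not_boundedCell_of_empty hne), if_neg]
    exact fun h => hne (h.1.imp fun x hx => ⟨hx.1, hx.2.2⟩)
  by_cases h0 : ∃ x ∈ W, k x = 0 ∧ 0 < g x ∧ ∀ φ ∈ T, 0 < φ x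
  · obtain ⟨u, hu, hku, hku'⟩ : ∃ u ∈ W, 0 < k u ∧ 0 < (-k) (-u) := by
      obtain ⟨u, hu, hku⟩ := hk
      rcases hku.lt_or_gt with h | h
      · exact ⟨-u, W.neg_mem hu, by simpa using h, by simpa using h⟩
      · exact ⟨u, hu, h, by simpa using h⟩
    have hp := exists_mem_insert_of_eq_zero hT hu hku h0
    have hm := exists_mem_insert_of_eq_zero (k := -k) hT (W.neg_mem hu) hku' (by simpa using h0)
    simp only [BoundedCell, hp, hm, hne, h0, true_and]
    simp only [Set.forall_mem_insert, LinearMap.neg_apply, neg_nonneg]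
    by_cases hK : ∀ x ∈ W, g x = 0 → (∀ φ ∈ T, 0 ≤ φ x) → x = 0
    · rw [if_pos fun x a b c => hK x a b c.2, if_pos fun x a b c => hK x a b c.2, if_pos hK,
        if_pos fun x a _ b c => hK x a b c]
    rw [if_neg hK, zero_add]
    by_cases hK0 : ∀ x ∈ W, k x = 0 → g x = 0 → (∀ φ ∈ T, 0 ≤ φ x) → x = 0
    · rw [if_pos hK0]
      push Not at hK
      obtain ⟨u, hu, hgu, hTu, hu0⟩ := hK
      rcases le_total 0 (k u) with hk | hk
      · rw [if_neg fun h => hu0 (h u hu hgu ⟨hk, hTu⟩), zero_add, if_pos]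
        exact fun v hv hgv hTv =>
          eq_zero_of_mem_recession hess hK0 hu hgu hTu hk hu0 hv hgv hTv.2 hTv.1
      · rw [if_neg (c := ∀ x ∈ W, g x = 0 → (k x ≤ 0 ∧ ∀ φ ∈ T, 0 ≤ φ x) → x = 0)
          fun h => hu0 (h u hu hgu ⟨hk, hTu⟩), add_zero, if_pos]
        exact fun v hv hgv hTv =>
          eq_zero_of_mem_recession (k := -k) hess (by simpa using hK0) hu hgu hTu (by simpa using hk)
            hu0 hv hgv hTv.2 (by simpa using hTv.1)
    · rw [if_neg hK0, if_neg, if_neg, add_zero]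
      · exact fun h => hK0 fun x a b c d => h x a c ⟨b.le, d⟩
      · exact fun h => hK0 fun x a b c d => h x a c ⟨b.ge, d⟩
  · rw [if_neg (c := _ ∧ _) fun h => h0 h.1, add_zero]
    -- The cell is convex and misses `ker k`, so `k` has constant sign on it.
    have hsign : ∀ x ∈ W, 0 < g x → (∀ φ ∈ T, 0 < φ x) → ∀ y ∈ W, 0 < g y → (∀ φ ∈ T, 0 < φ y) →
        0 < k x → 0 < k y := by
      intro x hx hgx hTx y hy hgy hTy hkx
      by_contra! hky
      rcases hky.eq_or_lt with hky | hky
      · exact h0 ⟨y, hy, hky, hgy, hTy⟩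
      have hky' := neg_pos.2 hky
      refine h0 ⟨(-k y) • x + k x • y, W.add_mem (W.smul_mem _ hx) (W.smul_mem _ hy),
        by simp; ring, ?_, fun φ hφ => ?_⟩
      · simp only [map_add, map_smul, smul_eq_mul]
        positivity
      · have h1 := hTx φ hφ
        have h2 := hTy φ hφ
        simp only [map_add, map_smul, smul_eq_mul]
        positivity
    obtain ⟨x, hx, hgx, hTx⟩ := id hne
    have hempty : ∀ l : Module.Dual ℝ V,
        (∀ y ∈ W, 0 < g y → (∀ φ ∈ T, 0 < φ y) → 0 < l y) → ¬BoundedCell (insert (-l) T) g W := by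
      rintro l hl ⟨⟨y, hy, hgy, hTy⟩, -⟩
      have h1 := hl y hy hgy fun φ hφ => hTy φ (Or.inr hφ)
      have h2 := hTy (-l) (Or.inl rfl)
      simp only [LinearMap.neg_apply] at h2
      linarith
    by_cases hkx : 0 < k x
    · have hpos : ∀ y ∈ W, 0 < g y → (∀ φ ∈ T, 0 < φ y) → 0 < k y := fun y hy hgy hTy =>
        hsign x hx hgx hTx y hy hgy hTy hkx
      rw [if_neg (hempty k hpos), add_zero]
      simp only [boundedCell_insert_iff_of_pos hne hpos]
    · have hpos : ∀ y ∈ W, 0 < g y → (∀ φ ∈ T, 0 < φ y) → 0 < (-k) y := by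
        intro y hy hgy hTy
        rcases lt_trichotomy (k y) 0 with h | h | h
        · simpa using h
        · exact absurd ⟨y, hy, h, hgy, hTy⟩ h0
        · exact absurd (hsign y hy hgy hTy x hx hgx hTx h) hkx
      rw [if_neg (by simpa using hempty (-k) hpos), zero_add]
      simp only [boundedCell_insert_iff_of_pos hne hpos]

theorem finrank_eq_finrank_inf_ker_add_one [FiniteDimensional ℝ V] (hk : ∃ u ∈ W, k u ≠ 0) :
    Module.finrank ℝ W = Module.finrank ℝ (W ⊓ LinearMap.ker k : Submodule ℝ V) + 1 := by
  have h1 : k.domRestrict W ≠ 0 := by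
    obtain ⟨u, hu, hku⟩ := hk
    exact fun h => hku (by simpa using LinearMap.congr_fun h ⟨u, hu⟩)
  rw [← Module.Dual.finrank_ker_add_one_of_ne_zero h1, ← Submodule.map_comap_subtype]
  congr 1
  exact (Submodule.equivMapOfInjective _ W.injective_subtype _).finrank_eq

variable {ι : Type*}

open Classical in
/-- The linear forms `f` with the sign vector that is positive exactly on `P`. -/
noncomputable def signed (f : ι → Module.Dual ℝ V) (P : Finset ι) (i : ι) : Module.Dual ℝ V :=
  if i ∈ P then f i else -f i

theorem image_signed_insert_of_subset [DecidableEq ι] (f : ι → Module.Dual ℝ V) {i : ι}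
    {s P : Finset ι} (hi : i ∉ s) (hP : P ⊆ s) :
    signed f P '' (insert i s : Finset ι) = insert (-f i) (signed f P '' s) := by
  rw [Finset.coe_insert, Set.image_insert_eq, signed, if_neg fun h => hi (hP h)]

theorem image_signed_insert_insert [DecidableEq ι] (f : ι → Module.Dual ℝ V) {i : ι} {s : Finset ι}
    (hi : i ∉ s) (P : Finset ι) :
    signed f (insert i P) '' (insert i s : Finset ι) = insert (f i) (signed f P '' s) := by
  rw [Finset.coe_insert, Set.image_insert_eq, signed, if_pos (Finset.mem_insert_self _ _)]
  congr 1
  refine Set.image_congr fun j hj => ?_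
  have hj' : j ≠ i := fun h => hi (h ▸ hj)
  simp [signed, hj']

theorem forall_image_signed_eq_zero {f : ι → Module.Dual ℝ V} {s P : Finset ι} {x : V} :
    (∀ φ ∈ signed f P '' s, φ x = 0) ↔ ∀ i ∈ s, f i x = 0 := by
  rw [Set.forall_mem_image]
  refine forall₂_congr fun i _ => ?_
  unfold signed
  split_ifs <;> simp

open Classical in
/-- The number of bounded cells of an essential affine arrangement, in Zaslavsky's form. The cells are
those of the slice `g = 1` of `W` cut by the forms `f i`, and the right hand side sums `(-1) ^ |B|` over
the sets `B` of hyperplanes with a common point in that slice. The induction on `s` runs over all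
subspaces `W` at once, since restriction to `ker (f i)` replaces `W` by a smaller subspace. -/
theorem sum_boundedCell (f : ι → Module.Dual ℝ V) [FiniteDimensional ℝ V] (s : Finset ι) :
    ∀ W : Submodule ℝ V, (∀ x ∈ W, g x = 0 → (∀ i ∈ s, f i x = 0) → x = 0) →
      ∑ P ∈ s.powerset, (if BoundedCell (signed f P '' s) g W then (1 : ℤ) else 0) =
        (-1) ^ (Module.finrank ℝ W + 1) * ∑ B ∈ s.powerset, (-1) ^ B.card *
          (if ∃ x ∈ W, (∀ i ∈ B, f i x = 0) ∧ g x ≠ 0 then 1 else 0) := by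
  induction s using Finset.induction_on with
  | empty =>
    intro W hW
    have hW' : ∀ x ∈ W, g x = 0 → x = 0 := by simpa using hW
    by_cases h : ∃ x ∈ W, g x ≠ 0
    · obtain ⟨x, hx, hgx⟩ := h
      have hfin : Module.finrank ℝ W = 1 := by
        refine finrank_eq_one (⟨x, hx⟩ : W) (by simpa using fun h : x = 0 => hgx (by simp [h])) ?_
        rintro ⟨y, hy⟩
        refine ⟨g y / g x, Subtype.ext ?_⟩
        have := hW' ((g y / g x) • x - y) (W.sub_mem (W.smul_mem _ hx) hy) (by simp [hgx])
        exact sub_eq_zero.1 this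
      have hb : BoundedCell (∅ : Set (Module.Dual ℝ V)) g W := by
        refine ⟨?_, by simpa using hW'⟩
        rcases hgx.lt_or_gt with h | h
        · exact ⟨-x, W.neg_mem hx, by simpa using h, by simp⟩
        · exact ⟨x, hx, h, by simp⟩
      have h' : ∃ x ∈ W, g x ≠ 0 := ⟨x, hx, hgx⟩
      simp [hb, hfin, h']
    · have hb : ¬BoundedCell (∅ : Set (Module.Dual ℝ V)) g W := fun hb =>
        h (hb.1.imp fun x hx => ⟨hx.1, hx.2.1.ne'⟩)
      simp [hb, h]
  | insert i s hi ih =>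
    intro W hW
    have hres : ∀ B : Finset ι, (∃ x ∈ W, (∀ j ∈ insert i B, f j x = 0) ∧ g x ≠ 0) ↔
        ∃ x ∈ W ⊓ LinearMap.ker (f i), (∀ j ∈ B, f j x = 0) ∧ g x ≠ 0 := fun B => by
      simp [and_assoc]
    rw [Finset.sum_powerset_insert hi, Finset.sum_powerset_insert hi, ← Finset.sum_add_distrib,
      ← Finset.sum_add_distrib]
    have hcard : ∀ B ∈ s.powerset, (insert i B).card = B.card + 1 := fun B hB =>
      Finset.card_insert_of_notMem fun h => hi (Finset.mem_powerset.1 hB h)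
    have hL : ∀ P ∈ s.powerset,
        ((if BoundedCell (signed f P '' (insert i s : Finset ι)) g W then (1 : ℤ) else 0) +
        if BoundedCell (signed f (insert i P) '' (insert i s : Finset ι)) g W then 1 else 0) =
        (if BoundedCell (insert (f i) (signed f P '' s)) g W then 1 else 0) +
        (if BoundedCell (insert (-f i) (signed f P '' s)) g W then 1 else 0) := fun P hP => by
      rw [image_signed_insert_of_subset f hi (Finset.mem_powerset.1 hP),
        image_signed_insert_insert f hi, add_comm]
    have hR : ∀ B ∈ s.powerset,
        ((-1 : ℤ) ^ B.card * (if ∃ x ∈ W, (∀ i ∈ B, f i x = 0) ∧ g x ≠ 0 then 1 else 0) +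
          (-1) ^ (insert i B).card *
            (if ∃ x ∈ W, (∀ j ∈ insert i B, f j x = 0) ∧ g x ≠ 0 then 1 else 0)) =
        (-1) ^ B.card * (if ∃ x ∈ W, (∀ i ∈ B, f i x = 0) ∧ g x ≠ 0 then 1 else 0) -
        (-1) ^ B.card * (if ∃ x ∈ W ⊓ LinearMap.ker (f i), (∀ i ∈ B, f i x = 0) ∧ g x ≠ 0
          then 1 else 0) := fun B hB => by
      simp only [hcard B hB, hres]
      ring
    rw [Finset.sum_congr rfl hL, Finset.sum_congr rfl hR]
    by_cases hk : ∃ u ∈ W, f i u ≠ 0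
    swap
    · -- `f i` vanishes on `W`: there is no cell, and the two halves of the sum cancel.
      push Not at hk
      have hW0 : W ⊓ LinearMap.ker (f i) = W := inf_eq_left.2 fun x hx => hk x hx
      rw [hW0]
      simp only [sub_self, Finset.sum_const_zero, mul_zero]
      refine Finset.sum_eq_zero fun P _ => ?_
      rw [if_neg, if_neg, add_zero]
      · rintro ⟨⟨x, hx, -, h⟩, -⟩
        simpa [hk x hx] using h _ (Or.inl rfl)
      · rintro ⟨⟨x, hx, -, h⟩, -⟩
        simpa [hk x hx] using h _ (Or.inl rfl)
    by_cases hess : ∀ x ∈ W, g x = 0 → (∀ j ∈ s, f j x = 0) → x = 0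
    · have hdim := finrank_eq_finrank_inf_ker_add_one hk
      have hess0 : ∀ x ∈ W ⊓ LinearMap.ker (f i), g x = 0 → (∀ j ∈ s, f j x = 0) → x = 0 :=
        fun x hx hgx hsx => hess x hx.1 hgx hsx
      rw [Finset.sum_congr rfl fun P _ => boundedCell_deletion_restriction
        (s.finite_toSet.image _) hk (by simpa only [forall_image_signed_eq_zero] using hess),
        Finset.sum_add_distrib, ih W hess, ih _ hess0, Finset.sum_sub_distrib, hdim]
      ring
    · -- `f i` separates a line on which `g` and all `f j` with `j ∈ s` vanish: this line is a
      -- recession direction, so no cell is bounded, and restricting to `ker (f i)` loses nothing.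
      push Not at hess
      obtain ⟨u, hu, hgu, hsu, hu0⟩ := hess
      have hfu : f i u ≠ 0 := fun h => hu0 (hW u hu hgu (by simpa [h] using hsu))
      have hno : ∀ P, ∀ l : Module.Dual ℝ V, l u ≠ 0 →
          ¬BoundedCell (insert l (signed f P '' s)) g W := by
        rintro P l hl ⟨-, h⟩
        have hP : ∀ φ ∈ signed f P '' s, φ u = 0 := forall_image_signed_eq_zero.2 hsu
        rcases hl.lt_or_gt with h' | h'
        · refine hu0 (neg_eq_zero.1 (h (-u) (W.neg_mem hu) (by simp [hgu]) ?_))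
          rintro φ (rfl | hφ)
          · simpa using h'.le
          · simp [hP φ hφ]
        · refine hu0 (h u hu hgu ?_)
          rintro φ (rfl | hφ)
          exacts [h'.le, (hP φ hφ).ge]
      rw [Finset.sum_eq_zero, Finset.sum_eq_zero, mul_zero]
      · intro B hB
        have : (∃ x ∈ W, (∀ j ∈ B, f j x = 0) ∧ g x ≠ 0) ↔
            ∃ x ∈ W ⊓ LinearMap.ker (f i), (∀ j ∈ B, f j x = 0) ∧ g x ≠ 0 := by
          constructor
          · rintro ⟨x, hx, hBx, hgx⟩
            refine ⟨x - (f i x / f i u) • u, ⟨W.sub_mem hx (W.smul_mem _ hu), by simp [hfu]⟩,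
              fun j hj => ?_, by simpa [hgu] using hgx⟩
            simp [hBx j hj, hsu j (Finset.mem_powerset.1 hB hj)]
          · rintro ⟨x, hx, h⟩
            exact ⟨x, hx.1, h⟩
        simp only [this, sub_self]
      · intro P _
        rw [if_neg (hno P _ hfu), if_neg (hno P _ (by simpa using hfu)), add_zero]

end BoundedCells

end CentralArrangement

namespace CentralArrangement

/-! ### Whitney's theorem for the characteristic polynomial -/

section Whitney

variable {V : Type*} [AddCommGroup V] [Module ℝ V] (A : CentralArrangement V)

open Classical in
theorem sum_ite_inf_eq (B : Finset (Submodule ℝ V))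
    (S : Finset A.IntersectionLattice) (F : Submodule ℝ V → ℤ) :
    ∑ X ∈ S, (if B.inf id = (OrderDual.ofDual X).1 then F (OrderDual.ofDual X).1 else 0) =
      if ∃ X ∈ S, B.inf id = (OrderDual.ofDual X).1 then F (B.inf id) else 0 := by
  split_ifs with h
  · obtain ⟨X, hX, hBX⟩ := h
    rw [Finset.sum_eq_single_of_mem X hX, if_pos hBX, hBX]
    exact fun Y _ hY => if_neg fun h => hY (Subtype.ext (h.symm.trans hBX))
  · exact Finset.sum_eq_zero fun X hX => if_neg fun h' => h ⟨X, hX, h'⟩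

open Classical in
/-- The cross-cut formula `μ(V, X) = ∑ (-1) ^ |B|`, over the sets `B` of hyperplanes with intersection
`X`. Summed over all flats containing `X`, the right hand side runs over all sets of hyperplanes
containing `X`, so it satisfies the recursion that defines `μ`. -/
theorem mu_wholeSpace (X : A.IntersectionLattice) :
    IncidenceAlgebra.mu ℤ A.wholeSpace X =
      ∑ B ∈ A.hyperplanes.powerset,
        if B.inf id = (OrderDual.ofDual X).1 then (-1 : ℤ) ^ B.card else 0 := by
  have hle : ∀ Y, A.wholeSpace ≤ Y := fun Y => show (OrderDual.ofDual Y).1 ≤ ⊤ from le_top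
  have hsum : ∀ X : A.IntersectionLattice, ∑ Y ∈ Finset.Icc A.wholeSpace X,
      (∑ B ∈ A.hyperplanes.powerset,
        if B.inf id = (OrderDual.ofDual Y).1 then (-1 : ℤ) ^ B.card else 0) =
      if A.wholeSpace = X then 1 else 0 := by
    intro X
    rw [Finset.sum_comm]
    have h1 : ∀ B ∈ A.hyperplanes.powerset,
        (∑ Y ∈ Finset.Icc A.wholeSpace X,
          if B.inf id = (OrderDual.ofDual Y).1 then (-1 : ℤ) ^ B.card else 0) =
        if B ⊆ A.hyperplanes.filter ((OrderDual.ofDual X).1 ≤ ·) then (-1) ^ B.card else 0 := by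
      intro B hB
      rw [A.sum_ite_inf_eq B _ fun _ => (-1) ^ B.card]
      refine if_congr ⟨?_, fun h => ?_⟩ rfl rfl
      · rintro ⟨Y, hY, hBY⟩ K hK
        have hYX : (OrderDual.ofDual X).1 ≤ (OrderDual.ofDual Y).1 := (Finset.mem_Icc.1 hY).2
        exact Finset.mem_filter.2 ⟨Finset.mem_powerset.1 hB hK,
          hYX.trans (hBY ▸ Finset.inf_le (f := id) hK)⟩
      · refine ⟨OrderDual.toDual ⟨B.inf id, Finset.mem_image_of_mem _ hB⟩,
          Finset.mem_Icc.2 ⟨hle _, ?_⟩, rfl⟩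
        show (OrderDual.ofDual X).1 ≤ B.inf id
        exact Finset.le_inf fun K hK => (Finset.mem_filter.1 (h hK)).2
    have h2 : A.hyperplanes.powerset.filter
        (· ⊆ A.hyperplanes.filter ((OrderDual.ofDual X).1 ≤ ·)) =
        (A.hyperplanes.filter ((OrderDual.ofDual X).1 ≤ ·)).powerset := by
      ext B
      simp only [Finset.mem_filter, Finset.mem_powerset, and_iff_right_iff_imp]
      exact fun h => h.trans (Finset.filter_subset _ _)
    rw [Finset.sum_congr rfl h1, ← Finset.sum_filter, h2, Finset.sum_powerset_neg_one_pow_card]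
    refine if_congr ⟨fun h => ?_, ?_⟩ rfl rfl
    · obtain ⟨B, hB, hBX⟩ := Finset.mem_image.1 (OrderDual.ofDual X).2
      have : B = ∅ := Finset.eq_empty_of_forall_notMem fun K hK => by
        have : K ∈ A.hyperplanes.filter ((OrderDual.ofDual X).1 ≤ ·) :=
          Finset.mem_filter.2 ⟨Finset.mem_powerset.1 hB hK, hBX ▸ Finset.inf_le (f := id) hK⟩
        simp [h] at this
      subst this
      exact Subtype.ext hBX
    · rintro rfl
      refine Finset.filter_eq_empty_iff.2 fun K hK h => ?_
      have hK' : K = ⊤ := top_le_iff.1 h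
      have := A.finrank_quotient K hK
      rw [hK', Module.finrank_zero_of_subsingleton] at this
      exact zero_ne_one this
  induction X using WellFoundedLT.induction with
  | _ X ih =>
    have h := (IncidenceAlgebra.sum_Icc_mu_right (𝕜 := ℤ) A.wholeSpace X).trans (hsum X).symm
    rw [← Finset.Ico_insert_right (hle X), Finset.sum_insert Finset.right_notMem_Ico,
      Finset.sum_insert Finset.right_notMem_Ico,
      Finset.sum_congr rfl fun Y hY => ih Y (Finset.mem_Ico.1 hY).2] at h
    exact add_right_cancel h

open Classical in
/-- Whitney's theorem, with an arbitrary weight `F` on flats in place of `t ^ dim X`. -/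
theorem sum_mu_mul (F : Submodule ℝ V → ℤ) :
    ∑ X : A.IntersectionLattice,
        IncidenceAlgebra.mu ℤ A.wholeSpace X * F (OrderDual.ofDual X).1 =
      ∑ B ∈ A.hyperplanes.powerset, (-1) ^ B.card * F (B.inf id) := by
  simp only [mu_wholeSpace, Finset.sum_mul, ite_mul, zero_mul]
  rw [Finset.sum_comm]
  refine Finset.sum_congr rfl fun B hB => ?_
  rw [A.sum_ite_inf_eq B _ fun X => (-1) ^ B.card * F X, if_pos]
  exact ⟨OrderDual.toDual ⟨B.inf id, Finset.mem_image_of_mem _ hB⟩, Finset.mem_univ _, rfl⟩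

theorem eval_derivative_charPoly :
    (Polynomial.derivative A.charPoly).eval 1 =
      ∑ B ∈ A.hyperplanes.powerset,
        (-1) ^ B.card * (Module.finrank ℝ (B.inf id : Submodule ℝ V) : ℤ) := by
  rw [← A.sum_mu_mul fun X => (Module.finrank ℝ X : ℤ), charPoly, Polynomial.derivative_sum,
    Polynomial.eval_finsetSum]
  refine Finset.sum_congr rfl fun X _ => ?_
  simp [Polynomial.derivative_X_pow]

end Whitney

/-! ### The beta invariant as an alternating sum -/

section Beta

variable {V : Type*} [AddCommGroup V] [Module ℝ V] (A : CentralArrangement V)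

/-- A choice of defining linear forms for the hyperplanes. -/
theorem exists_ker_eq : ∃ f : Submodule ℝ V → Module.Dual ℝ V,
    ∀ H ∈ A.hyperplanes, LinearMap.ker (f H) = H := by
  have h : ∀ H : Submodule ℝ V, ∃ φ : Module.Dual ℝ V,
      H ∈ A.hyperplanes → LinearMap.ker φ = H := by
    intro H
    by_cases hH : H ∈ A.hyperplanes
    · have h1 := A.finrank_quotient H hH
      have : Module.Finite ℝ (V ⧸ H) := Module.finite_of_finrank_eq_succ h1
      obtain ⟨e⟩ := Module.nonempty_linearEquiv_of_finrank_eq_one h1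
      exact ⟨e.symm.toLinearMap ∘ₗ H.mkQ, fun _ => by
        rw [LinearMap.ker_comp_of_ker_eq_bot _ e.symm.ker, Submodule.ker_mkQ]⟩
    · exact ⟨0, fun h => absurd h hH⟩
  choose f hf using h
  exact ⟨f, hf⟩

variable {A}

theorem mem_inf_iff {f : Submodule ℝ V → Module.Dual ℝ V}
    (hf : ∀ H ∈ A.hyperplanes, LinearMap.ker (f H) = H) {B : Finset (Submodule ℝ V)}
    (hB : B ⊆ A.hyperplanes) {x : V} : x ∈ B.inf id ↔ ∀ K ∈ B, f K x = 0 := by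
  rw [Submodule.mem_finsetInf]
  refine forall₂_congr fun K hK => ?_
  rw [← LinearMap.mem_ker, hf K (hB hK)]
  rfl

open Classical in
/-- Pairing `B` with `insert H B` in `∑ (-1) ^ |B| dim (⋂ B)` leaves the differences
`dim (⋂ B) - dim (⋂ B ∩ H)`, which are `1` or `0` according to whether `⋂ B` lies outside `H`. -/
theorem beta_eq_sum [FiniteDimensional ℝ V] (hA : A.IsEssential) {H : Submodule ℝ V}
    (hH : H ∈ A.hyperplanes) {f : Submodule ℝ V → Module.Dual ℝ V}
    (hf : ∀ K ∈ A.hyperplanes, LinearMap.ker (f K) = K) :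
    A.beta = (-1) ^ (Module.finrank ℝ (⊤ : Submodule ℝ V) + 1) *
      ∑ B ∈ (A.hyperplanes.erase H).powerset, (-1) ^ B.card *
        (if ∃ x ∈ (⊤ : Submodule ℝ V), (∀ K ∈ B, f K x = 0) ∧ f H x ≠ 0 then 1 else 0) := by
  have hrank : A.rank = Module.finrank ℝ V := by
    rw [rank, hA]
    exact (Submodule.quotEquivOfEqBot _ rfl).finrank_eq
  have hpos : 0 < Module.finrank ℝ V := by
    have := Submodule.finrank_quotient_le H
    rw [A.finrank_quotient H hH] at this
    exact this
  have hsign : (-1 : ℤ) ^ (A.rank - 1) = (-1) ^ (Module.finrank ℝ (⊤ : Submodule ℝ V) + 1) := by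
    rw [finrank_top, hrank]
    -- The dimension is positive, so the subtraction in the exponent is not truncated.
    obtain ⟨n, hn⟩ := Nat.exists_eq_succ_of_ne_zero hpos.ne'
    rw [hn, Nat.succ_eq_add_one, Nat.add_sub_cancel]
    ring
  rw [beta, eval_derivative_charPoly, hsign]
  congr 1
  conv_lhs => rw [← Finset.insert_erase hH]
  rw [Finset.sum_powerset_insert (Finset.notMem_erase H _), ← Finset.sum_add_distrib]
  refine Finset.sum_congr rfl fun B hB => ?_
  have hB := Finset.mem_powerset.1 hB
  have hB' := hB.trans (Finset.erase_subset _ _)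
  rw [Finset.card_insert_of_notMem fun h => Finset.notMem_erase H _ (hB h), Finset.inf_insert,
    id, pow_succ, inf_comm]
  have hiff : (∃ x ∈ (⊤ : Submodule ℝ V), (∀ K ∈ B, f K x = 0) ∧ f H x ≠ 0) ↔
      ∃ x ∈ B.inf id, f H x ≠ 0 := by
    simp [mem_inf_iff hf hB']
  rw [if_congr hiff rfl rfl]
  split_ifs with h
  · have := finrank_eq_finrank_inf_ker_add_one h
    rw [hf H hH] at this
    rw [this]
    push_cast
    ring
  · rw [inf_eq_left.2]
    · ring
    · intro x hx
      rw [← hf H hH]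
      by_contra hx'
      exact h ⟨x, hx, hx'⟩

end Beta

end CentralArrangement

namespace CentralArrangement

/-! ### Chambers and sign vectors -/

section Chambers

variable {V : Type*} [NormedAddCommGroup V] [NormedSpace ℝ V]

/-- A nonempty open polyhedral cone has the expected closure: a point of the closed cone is the limit
of its translates by small multiples of a point of the open cone. -/
theorem closure_setOf_forall_pos [FiniteDimensional ℝ V] {T : Set (Module.Dual ℝ V)}
    (hne : ∃ x, ∀ φ ∈ T, 0 < φ x) :
    closure {x | ∀ φ ∈ T, 0 < φ x} = {x | ∀ φ ∈ T, 0 ≤ φ x} := by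
  refine Set.Subset.antisymm (closure_minimal (fun x hx φ hφ => (hx φ hφ).le) ?_) ?_
  · simp only [Set.ofPred_forall]
    exact isClosed_biInter fun φ _ =>
      isClosed_le continuous_const φ.continuous_of_finiteDimensional
  · intro y hy
    obtain ⟨x, hx⟩ := hne
    have hc : Filter.Tendsto (fun t : ℝ => y + t • x) (nhdsWithin 0 (Set.Ioi 0)) (nhds y) := by
      have : Filter.Tendsto (fun t : ℝ => y + t • x) (nhds 0) (nhds (y + (0 : ℝ) • x)) :=
        Continuous.tendsto (by fun_prop) 0
      rw [zero_smul, add_zero] at this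
      exact this.mono_left nhdsWithin_le_nhds
    refine mem_closure_of_tendsto hc ?_
    filter_upwards [self_mem_nhdsWithin] with t ht φ hφ
    have h1 := hy φ hφ
    have h2 := hx φ hφ
    have h3 : 0 < t := ht
    simp only [map_add, map_smul, smul_eq_mul]
    positivity

variable {A : CentralArrangement V} {f : Submodule ℝ V → Module.Dual ℝ V}

theorem signed_apply_pos_iff {P : Finset (Submodule ℝ V)} {K : Submodule ℝ V} {x : V} :
    0 < signed f P K x ↔ (K ∈ P ∧ 0 < f K x) ∨ (K ∉ P ∧ f K x < 0) := by
  unfold signed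
  split_ifs with h <;> simp [h]

theorem mem_complement_iff (hf : ∀ K ∈ A.hyperplanes, LinearMap.ker (f K) = K) {x : V} :
    x ∈ A.complement ↔ ∀ K ∈ A.hyperplanes, f K x ≠ 0 := by
  refine forall₂_congr fun K hK => ?_
  rw [ne_eq, ← LinearMap.mem_ker, hf K hK]

open Classical in
/-- The connected components of the complement are the nonempty sign regions: these are convex, and
no connected subset of the complement can change the sign of some `f K`. -/
theorem connectedComponentIn_complement [FiniteDimensional ℝ V]
    (hf : ∀ K ∈ A.hyperplanes, LinearMap.ker (f K) = K) {P : Finset (Submodule ℝ V)} {v : V}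
    (hv : ∀ φ ∈ signed f P '' A.hyperplanes, 0 < φ v) :
    connectedComponentIn A.complement v =
      {x | ∀ φ ∈ signed f P '' A.hyperplanes, 0 < φ x} := by
  have hsub : {x | ∀ φ ∈ signed f P '' A.hyperplanes, 0 < φ x} ⊆ A.complement := by
    intro x hx
    refine (mem_complement_iff hf).2 fun K hK h => ?_
    have := hx _ (Set.mem_image_of_mem _ hK)
    rw [signed_apply_pos_iff] at this
    simp [h] at this
  refine Set.Subset.antisymm ?_ (IsPreconnected.subset_connectedComponentIn ?_ hv hsub)
  · rintro x hx _ ⟨K, hK, rfl⟩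
    have hvK := hv _ (Set.mem_image_of_mem _ hK)
    set ψ := signed f P K with hψ
    by_contra! hxK
    have hcont : Continuous ψ := ψ.continuous_of_finiteDimensional
    obtain ⟨y, hy, hy0⟩ := isPreconnected_connectedComponentIn.intermediate_value hx
      (mem_connectedComponentIn (hsub hv)) hcont.continuousOn ⟨hxK, hvK.le⟩
    refine (mem_complement_iff hf).1 (connectedComponentIn_subset _ _ hy) K hK ?_
    rw [hψ, signed] at hy0
    split_ifs at hy0
    · exact hy0
    · simpa using hy0
  · refine Convex.isPreconnected ?_
    simp only [Set.ofPred_forall]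
    exact convex_iInter₂ fun φ _ => convex_halfSpace_gt φ.isLinear 0

open Classical in
theorem chambers_eq [FiniteDimensional ℝ V]
    (hf : ∀ K ∈ A.hyperplanes, LinearMap.ker (f K) = K) :
    A.chambers = (fun P : Finset (Submodule ℝ V) =>
        {x | ∀ φ ∈ signed f P '' A.hyperplanes, 0 ≤ φ x}) ''
      {P | P ⊆ A.hyperplanes ∧ ∃ x, ∀ φ ∈ signed f P '' A.hyperplanes, 0 < φ x} := by
  ext C
  constructor
  · rintro ⟨v, hv, rfl⟩
    have hv' : ∀ φ ∈ signed f (A.hyperplanes.filter (0 < f · v)) '' A.hyperplanes, 0 < φ v := by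
      rintro _ ⟨K, hK, rfl⟩
      rw [signed_apply_pos_iff, Finset.mem_filter]
      rcases ((mem_complement_iff hf).1 hv K hK).lt_or_gt with h | h
      · exact Or.inr ⟨fun h' => lt_asymm h h'.2, h⟩
      · exact Or.inl ⟨⟨hK, h⟩, h⟩
    refine ⟨_, ⟨Finset.filter_subset _ _, v, hv'⟩, ?_⟩
    rw [connectedComponentIn_complement hf hv', closure_setOf_forall_pos ⟨v, hv'⟩]
  · rintro ⟨P, ⟨-, v, hv⟩, rfl⟩
    have hc := connectedComponentIn_complement hf hv
    refine ⟨v, ?_, ?_⟩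
    · exact connectedComponentIn_subset _ v (hc ▸ hv)
    · rw [hc, closure_setOf_forall_pos ⟨v, hv⟩]

/-- Sign vectors with nonempty open cell are determined by the closed cell: an interior point of one
violates an inequality of any other. -/
theorem injOn_closedCell :
    Set.InjOn (fun P : Finset (Submodule ℝ V) =>
        {x | ∀ φ ∈ signed f P '' A.hyperplanes, 0 ≤ φ x})
      {P | P ⊆ A.hyperplanes ∧ ∃ x, ∀ φ ∈ signed f P '' A.hyperplanes, 0 < φ x} := by
  have key : ∀ P Q : Finset (Submodule ℝ V), P ⊆ A.hyperplanes →
      (∃ x, ∀ φ ∈ signed f P '' A.hyperplanes, 0 < φ x) →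
      {x | ∀ φ ∈ signed f P '' A.hyperplanes, 0 ≤ φ x} =
        {x | ∀ φ ∈ signed f Q '' A.hyperplanes, 0 ≤ φ x} → P ⊆ Q := by
    rintro P Q hP ⟨x, hx⟩ h K hK
    by_contra hKQ
    have h1 := hx _ (Set.mem_image_of_mem _ (hP hK))
    have h2 : x ∈ {x | ∀ φ ∈ signed f Q '' A.hyperplanes, 0 ≤ φ x} :=
      h ▸ fun φ hφ => (hx φ hφ).le
    have h3 := h2 _ (Set.mem_image_of_mem _ (hP hK))
    simp only [signed, hK, hKQ, if_true, if_false, LinearMap.neg_apply] at h1 h3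
    linarith
  exact fun P hP Q hQ h => (key P Q hP.1 hP.2 h).antisymm (key Q P hQ.1 hQ.2 h.symm)

open Classical in
/-- The chambers meeting `H` only at the origin, indexed by sign vectors. -/
theorem chambers_inter_eq [FiniteDimensional ℝ V]
    (hf : ∀ K ∈ A.hyperplanes, LinearMap.ker (f K) = K) (H : Submodule ℝ V) :
    {C | C ∈ A.chambers ∧ C ∩ (H : Set V) = {0}} =
      (fun P : Finset (Submodule ℝ V) => {x | ∀ φ ∈ signed f P '' A.hyperplanes, 0 ≤ φ x}) ''
        (A.hyperplanes.powerset.filter fun P =>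
          (∃ x, ∀ φ ∈ signed f P '' A.hyperplanes, 0 < φ x) ∧
            ∀ x ∈ H, (∀ φ ∈ signed f P '' A.hyperplanes, 0 ≤ φ x) → x = 0 :
          Finset (Finset (Submodule ℝ V))) := by
  have hiff : ∀ P : Finset (Submodule ℝ V),
      {x | ∀ φ ∈ signed f P '' A.hyperplanes, 0 ≤ φ x} ∩ (H : Set V) = {0} ↔
        ∀ x ∈ H, (∀ φ ∈ signed f P '' A.hyperplanes, 0 ≤ φ x) → x = 0 := by
    intro P
    refine ⟨fun h x hx hPx => Set.mem_singleton_iff.1 (h ▸ ⟨hPx, hx⟩), fun h => ?_⟩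
    refine Set.Subset.antisymm (fun x hx => h x hx.2 hx.1) ?_
    rintro _ rfl
    exact ⟨fun φ _ => (map_zero φ).ge, H.zero_mem⟩
  ext C
  rw [chambers_eq hf]
  constructor
  · rintro ⟨⟨P, ⟨hP, hne⟩, rfl⟩, hC⟩
    exact ⟨P, Finset.mem_coe.2 (Finset.mem_filter.2
      ⟨Finset.mem_powerset.2 hP, hne, (hiff P).1 hC⟩), rfl⟩
  · rintro ⟨P, hP, rfl⟩
    obtain ⟨hP, hne, hC⟩ := Finset.mem_filter.1 (Finset.mem_coe.1 hP)
    exact ⟨⟨P, ⟨Finset.mem_powerset.1 hP, hne⟩, rfl⟩, (hiff P).2 hC⟩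

/-- The cells bounded in the slice `g = 1` are the sign regions on the positive side of `g` whose
closure meets `ker g` only at the origin. -/
theorem boundedCell_top_iff {T : Set (Module.Dual ℝ V)} {g : Module.Dual ℝ V}
    {H : Submodule ℝ V} (hg : LinearMap.ker g = H) :
    BoundedCell T g ⊤ ↔ (∃ x, ∀ φ ∈ insert g T, 0 < φ x) ∧
      ∀ x ∈ H, (∀ φ ∈ insert g T, 0 ≤ φ x) → x = 0 := by
  subst hg
  simp only [BoundedCell, Set.forall_mem_insert, Submodule.mem_top, true_and, true_implies,
    LinearMap.mem_ker]
  exact and_congr Iff.rfl ⟨fun h x hx hT => h x hx hT.2, fun h x hx hT => h x hx ⟨hx.ge, hT⟩⟩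

open Classical in
/-- Each side of `H` contributes `β`: the alternating sum computing `β` depends on `f H` only through
its kernel, so it counts the bounded cells for `f H` as well as those for `-f H`. -/
theorem card_filter_eq_two_mul_beta [FiniteDimensional ℝ V] (hA : A.IsEssential)
    {H : Submodule ℝ V} (hH : H ∈ A.hyperplanes)
    (hf : ∀ K ∈ A.hyperplanes, LinearMap.ker (f K) = K) :
    ((A.hyperplanes.powerset.filter fun P =>
      (∃ x, ∀ φ ∈ signed f P '' A.hyperplanes, 0 < φ x) ∧
        ∀ x ∈ H, (∀ φ ∈ signed f P '' A.hyperplanes, 0 ≤ φ x) → x = 0).card : ℤ) =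
      2 * A.beta := by
  have hns := Finset.notMem_erase H A.hyperplanes
  have hess : ∀ x ∈ (⊤ : Submodule ℝ V), f H x = 0 →
      (∀ K ∈ A.hyperplanes.erase H, f K x = 0) → x = 0 := by
    intro x _ hx hs
    have : x ∈ A.center := by
      refine (mem_inf_iff hf subset_rfl).2 fun K hK => ?_
      by_cases h : K = H
      · exact h ▸ hx
      · exact hs K (Finset.mem_erase.2 ⟨h, hK⟩)
    rw [hA] at this
    exact this
  have hplus := sum_boundedCell (g := f H) f (A.hyperplanes.erase H) ⊤ hess
  have hminus := sum_boundedCell (g := -f H) f (A.hyperplanes.erase H) ⊤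
    (by simpa only [LinearMap.neg_apply, neg_eq_zero] using hess)
  simp only [LinearMap.neg_apply, ne_eq, neg_eq_zero] at hminus
  simp only [ne_eq] at hplus
  have hβ := beta_eq_sum hA hH hf
  simp only [ne_eq] at hβ
  rw [← hβ] at hplus hminus
  rw [two_mul]
  nth_rewrite 1 [← hminus]
  rw [← hplus, Finset.natCast_card_filter]
  conv_lhs => rw [← Finset.insert_erase hH]
  rw [Finset.sum_powerset_insert hns]
  congr 1
  · refine Finset.sum_congr rfl fun P hP => if_congr ?_ rfl rfl
    rw [image_signed_insert_of_subset f hns (Finset.mem_powerset.1 hP),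
      boundedCell_top_iff ((LinearMap.ker_neg _).trans (hf H hH))]
  · refine Finset.sum_congr rfl fun P hP => if_congr ?_ rfl rfl
    rw [image_signed_insert_insert f hns, boundedCell_top_iff (hf H hH)]

end Chambers

end CentralArrangement

open CentralArrangement in
theorem corollary2p8 {V : Type*} [NormedAddCommGroup V] [NormedSpace ℝ V]
    [FiniteDimensional ℝ V] (A : CentralArrangement V) (hA : A.IsEssential)
    (H : Submodule ℝ V) (hH : H ∈ A.hyperplanes) :
    {C | C ∈ A.chambers ∧ C ∩ (H : Set V) = {0}}.Finite ∧
      (A.beta : ℚ) = ({C | C ∈ A.chambers ∧ C ∩ (H : Set V) = {0}}.ncard : ℚ) / 2 := by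
  classical
  obtain ⟨f, hf⟩ := A.exists_ker_eq
  rw [chambers_inter_eq hf H]
  refine ⟨(Finset.finite_toSet _).image _, ?_⟩
  rw [Set.InjOn.ncard_image, Set.ncard_coe_finset]
  · have h := congrArg (Int.cast : ℤ → ℚ) (card_filter_eq_two_mul_beta hA hH hf)
    rw [Int.cast_natCast, Int.cast_mul] at h
    rw [h]
    push_cast
    ring
  · refine injOn_closedCell.mono fun P hP => ?_
    obtain ⟨hP, hne, -⟩ := Finset.mem_filter.1 (Finset.mem_coe.1 hP)
    exact ⟨Finset.mem_powerset.1 hP, hne⟩
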